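/- **Setting.** Consider a stochastic bandit with arms $a\in\{1,\dots,n\}$ and a mediator with values in a finite set $\mathcal M$ of size $K$. When arm $A_t=a$ is pulled in round $t$, a tuple $(M_t,O_t,Y_t)\in\mathcal M\times\{0,1\}\times\mathbb R$ is drawn, given the past and $A_t=a$, from a fixed unknown law $\nu_a$. The agent always sees $M_t$ and $O_t$, and sees the reward $Y_t$ only if $O_t=1$. Write $$p_{m,a}=\mathbb P(M_t=m\mid A_t=a),\quad \gamma_{m,a}=\mathbb P(O_t=1\mid M_t=m,A_t=a),\quad \mu_a=\mathbb E[Y_t\mid A_t=a],\quad \mu_{m,a}=\mathbb E[Y_t\mid M_t=m,A_t=a].$$ Assume: * positivity: $p_{m,a}>0$ and $\gamma_{m,a}>0$ for all $m,a$; * missingness at random (MAR): $O_t\perp Y_t\mid (A_t,M_t)$; * $\mu_{m,a}\in[0,1]$ for all $m,a$, and the rewards are sub-Gaussian: for some $\sigma^2\ge 0$, $\mathbb E[e^{s(Y_t-\mu_{m,a})}\mid M_t=m,A_t=a]\le e^{\sigma^2s^2/2}$ for all $s\in\mathbb R$ and all $m,a$. Let $P_a=\sum_{m}p_{m,a}/\gamma_{m,a}$,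 $S=\frac1n\sum_a P_a$, and $R_T=\sum_{t=1}^T\big(\max_a\mu_a-\mu_{A_t}\big)$. **Algorithm** (horizon $T$, exploration parameter $\alpha$, the probabilities $p_{m,a}$ known). First pull every arm $\lceil\log^2T\rceil$ times, one arm after the other. In each of the remaining rounds up to round $T$, let $T_{m,a,o}$ be the number of past rounds in which arm $a$ was pulled, the mediator was $m$ and the reward was observed, let $\hat\mu_{m,a}$ be the average of the rewards observed in these rounds, and pull an arm that maximizes $$\mathrm{UCB}_a=\sum_{m}p_{m,a}\hat\mu_{m,a}+\sqrt{\frac{\alpha\log T}{2}\sum_{m}\frac{p_{m,a}^2}{T_{m,a,o}}},$$ ties being broken arbitrarily and $\mathrm{UCB}_a=+\infty$ if $T_{m,a,o}=0$ for some $m$. **Theorem.** There is a universal constant $C>0$ such that, for every $\alpha>1$, the algorithm satisfies, for all sufficiently large $T$, $$\mathbb E[R_T]\le C\sqrt{\alpha\,T\log(T)\,n\,S}.$$ More precisely: 1. if the rewards are sub-Gaussian with $\sigma^2=1/4$ (for example, if $Y_t\in[0,1]$), this holds for all $T\ge T_0$ with a $T_0$ that depends only on $\alpha$, $n$, $K$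 and the values $(p_{m,a})$, $(\gamma_{m,a})$, and not otherwise on the laws $\nu_a$ (in particular, not on the gaps $\max_b\mu_b-\mu_a$); 2. for an arbitrary $\sigma^2$, this holds for all $T\ge T_0$ with a $T_0$ that depends on $\alpha$ and on the laws $(\nu_a)_a$. -/

import Mathlib

open MeasureTheory ProbabilityTheory
open scoped NNReal

noncomputable section

namespace MARBandit

/-- What one pull of an arm generates: the tuple `(M, O, Y)` of the (fully observed) mediator `M`,
the indicator `O` telling whether the reward is observed, and the reward `Y`. -/
abbrev Outcome (K : ℕ) : Type := Fin K × Bool × ℝ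

/-- The mediator `M`. -/
def med {K : ℕ} (z : Outcome K) : Fin K := z.1

/-- The indicator `O` that the reward is observed. -/
def obs {K : ℕ} (z : Outcome K) : Bool := z.2.1

/-- The reward `Y`; it is shown to the agent only if `obs z = true`. -/
def rew {K : ℕ} (z : Outcome K) : ℝ := z.2.2

/-! ### The environment: `ν a` is the law of `(M, O, Y)` when arm `a` is pulled -/

section Environment

variable {n K : ℕ} (ν : Fin n → Measure (Outcome K))

/-- The conditional law of `(M, O, Y)` given that arm `a` is pulled and `M = m`. -/
def condLaw (a : Fin n) (m : Fin K) : Measure (Outcome K) :=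
  cond (ν a) {z | med z = m}

/-- `p_{m,a} = P(M = m | A = a)`. -/
def medProb (a : Fin n) (m : Fin K) : ℝ := (ν a).real {z | med z = m}

/-- `γ_{m,a} = P(O = 1 | M = m, A = a)`. -/
def obsProb (a : Fin n) (m : Fin K) : ℝ := (condLaw ν a m).real {z | obs z = true}

/-- `μ_a = E[Y | A = a]`. -/
def armMean (a : Fin n) : ℝ := ∫ z, rew z ∂(ν a)

/-- `E[Y | M = m, A = a]`. -/
def condMean (a : Fin n) (m : Fin K) : ℝ := ∫ z, rew z ∂(condLaw ν a m)

/-- The mean reward of an optimal arm. -/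
def bestMean : ℝ := ⨆ a, armMean ν a

/-- Missing at random: `O` and `Y` are conditionally independent given the arm and the mediator. -/
def MissingAtRandom : Prop :=
  ∀ a m, IndepFun obs rew (condLaw ν a m)

/-- Given the arm and the mediator, the reward is sub-Gaussian with variance proxy `c`, that is,
`E[exp (s (Y - E[Y | m, a])) | m, a] ≤ exp (c s² / 2)` for all real `s`. -/
def SubGaussianRewards (c : ℝ≥0) : Prop :=
  ∀ a m, HasSubgaussianMGF (fun z => rew z - condMean ν a m) c (condLaw ν a m)

/-- The environment has mediator probabilities `p` and observation probabilities `γ`, all of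
them positive; rewards are missing at random, have conditional means in `[0, 1]`, and are
sub-Gaussian with variance proxy `c`. -/
structure IsMAREnvironment (p γ : Fin n → Fin K → ℝ) (c : ℝ≥0) : Prop where
  isProb : ∀ a, IsProbabilityMeasure (ν a)
  medProb_eq : ∀ a m, medProb ν a m = p a m
  obsProb_eq : ∀ a m, obsProb ν a m = γ a m
  medProb_pos : ∀ a m, 0 < medProb ν a m
  obsProb_pos : ∀ a m, 0 < obsProb ν a m
  mar : MissingAtRandom ν
  condMean_mem : ∀ a m, condMean ν a m ∈ Set.Icc (0 : ℝ) 1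
  subGaussian : SubGaussianRewards ν c

end Environment

/-- `P_a = ∑_m p_{m,a} / γ_{m,a}`. -/
def armComplexity {n K : ℕ} (p γ : Fin n → Fin K → ℝ) (a : Fin n) : ℝ :=
  ∑ m, p a m / γ a m

/-- `S`, the arithmetic mean of the `P_a` over the arms. -/
def meanComplexity {n K : ℕ} (p γ : Fin n → Fin K → ℝ) : ℝ :=
  (∑ a, armComplexity p γ a) / n

/-! ### The algorithm

Rounds are numbered `0, 1, …, T - 1`. Below `A s` is the arm pulled in round `s` and `z s` is the
outcome of that pull. -/

section Algorithm

variable {n K : ℕ}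

/-- The rounds before round `t` in which arm `a` was pulled, the mediator was `m`, and the reward
was observed. -/
def obsRounds (A : ℕ → Fin n) (z : ℕ → Outcome K) (t : ℕ) (a : Fin n) (m : Fin K) : Finset ℕ :=
  (Finset.range t).filter fun s => A s = a ∧ med (z s) = m ∧ obs (z s) = true

/-- `T_{m,a,o}`, the number of observed rewards of arm `a` with mediator `m` before round `t`. -/
def obsCount (A : ℕ → Fin n) (z : ℕ → Outcome K) (t : ℕ) (a : Fin n) (m : Fin K) : ℕ :=
  (obsRounds A z t a m).card

/-- The average of the observed rewards of arm `a` with mediator `m` before round `t`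
(`0` if there are none). -/
def condEst (A : ℕ → Fin n) (z : ℕ → Outcome K) (t : ℕ) (a : Fin n) (m : Fin K) : ℝ :=
  (∑ s ∈ obsRounds A z t a m, rew (z s)) / obsCount A z t a m

/-- The mediator-stratified estimate of the mean reward of arm `a`. -/
def armEst (p : Fin n → Fin K → ℝ) (A : ℕ → Fin n) (z : ℕ → Outcome K) (t : ℕ) (a : Fin n) : ℝ :=
  ∑ m, p a m * condEst A z t a m

open Classical in
/-- The upper confidence bound of arm `a` at the start of round `t`; it is infinite while some
count `T_{m,a,o}` in its denominators is still zero. -/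
def ucb (α : ℝ) (T : ℕ) (p : Fin n → Fin K → ℝ) (A : ℕ → Fin n) (z : ℕ → Outcome K)
    (t : ℕ) (a : Fin n) : EReal :=
  if ∃ m, obsCount A z t a m = 0 then ⊤
  else ((armEst p A z t a +
    √(α * Real.log T / 2 * ∑ m, p a m ^ 2 / (obsCount A z t a m : ℝ)) : ℝ) : EReal)

/-- The number of forced pulls of each arm, `log² T` rounded up. -/
def forcedPulls (T : ℕ) : ℕ := ⌈Real.log T ^ 2⌉₊

/-- The arms pulled along a sequence of `T` rounds obey the algorithm with horizon `T`,
exploration parameter `α` and known mediator probabilities `p`: arm after arm is pulled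
`forcedPulls T` times, and from then on an arm with the largest upper confidence bound is pulled
(ties may be broken in any way). -/
def FollowsAlgorithm (α : ℝ) (T : ℕ) (p : Fin n → Fin K → ℝ)
    (A : ℕ → Fin n) (z : ℕ → Outcome K) : Prop :=
  ∀ t < T,
    (t < n * forcedPulls T → (A t : ℕ) = t / forcedPulls T) ∧
    (n * forcedPulls T ≤ t → ∀ a, ucb α T p A z t a ≤ ucb α T p A z t (A t))

end Algorithm

/-! ### The interaction of the agent with the environment -/

section Interaction

variable {n K : ℕ} {Ω : Type*} [mΩ : MeasurableSpace Ω]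

/-- A `T`-round interaction with the environment `ν`: `ℱ t` is the information available when
the arm `A t` of round `t` is chosen, and given this information the outcome `Z t` of round `t`
has law `ν (A t)`. -/
structure IsInteraction (T : ℕ) (ν : Fin n → Measure (Outcome K)) (P : Measure Ω)
    (ℱ : Filtration ℕ mΩ) (A : ℕ → Ω → Fin n) (Z : ℕ → Ω → Outcome K) : Prop where
  arm_measurable : ∀ t < T, Measurable[ℱ t] (A t)
  outcome_measurable : ∀ t < T, Measurable[ℱ (t + 1)] (Z t)
  outcome_law : ∀ t < T, ∀ F : Set Ω, MeasurableSet[ℱ t] F → ∀ a : Fin n,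
    ∀ B : Set (Outcome K), MeasurableSet B →
      P (F ∩ {ω | A t ω = a} ∩ Z t ⁻¹' B) = P (F ∩ {ω | A t ω = a}) * ν a B

/-- An interaction in which the agent uses the algorithm. -/
structure IsAlgorithmRun (α : ℝ) (T : ℕ) (p : Fin n → Fin K → ℝ)
    (ν : Fin n → Measure (Outcome K)) (P : Measure Ω)
    (ℱ : Filtration ℕ mΩ) (A : ℕ → Ω → Fin n) (Z : ℕ → Ω → Outcome K) : Prop where
  isProb : IsProbabilityMeasure P
  interaction : IsInteraction T ν P ℱ A Z
  follows : ∀ᵐ ω ∂P, FollowsAlgorithm α T p (fun t => A t ω) (fun t => Z t ω)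

/-- The cumulative regret `R_T = ∑_t (μ_{a*} - μ_{a_t})`, a random variable. -/
def regret (T : ℕ) (ν : Fin n → Measure (Outcome K)) (A : ℕ → Ω → Fin n) (ω : Ω) : ℝ :=
  ∑ t ∈ Finset.range T, (bestMean ν - armMean ν (A t ω))

end Interaction

end MARBandit

end

/-!
The proof compares the run with exponential weights. If `g a` is a function of the outcome with
`∫ exp (g a) ∂(ν a) ≤ 1` for every arm `a`, then `exp (∑ s < t, g (A s) (Z s))` has mean at most one
for every fixed round `t` (`IsInteraction.integrable_exp_sum`), whatever the agent does. So the
probability that concentration fails in round `t` is bounded by a sum of discounted weights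
(`totalWeight`), provided that each possible failure makes the exponent of one weight of a finite
family large. No independence of arms and no maximal inequality is needed, and since a round costs
at most one, failure probabilities of order `T ^ (-1/2)` per round are affordable.

Three kinds of failure occur, each with its own weights.

* Fewer than half of the expected rewards of some arm and mediator value are observed. As every arm
  is pulled at least `log² T` times, the weights of `countInc` detect this with an exponent of order
  `log² T` (`le_sum_countInc`).
* For variance proxy `1/4`, an arm estimate misses its mean by more than its confidence radius.
  Missingness at random makes `noiseInc` an admissible increment for every vector of weights on the
  mediator values. The best vector depends on the random counts, but rounding its coordinates to a
  geometric grid, in the direction given by the sign of the noise, keeps an exponent of at least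
  `(2/3) log T > (1/2) log T`, and the grid has polylogarithmic size (`exists_zpow_weights`).
* For an arbitrary variance proxy, an estimate misses its mean by more than a quarter of the
  smallest positive gap. With `log² T` pulls per arm a fixed weight vector detects this, again with
  an exponent of order `log² T`; the threshold now depends on the gaps.

If nothing fails in round `t`, optimism bounds the gap of the pulled arm by four times its radius
(`gap_le_of_ucb`), which is at most `4 √(α log T · P_a / k)` after `k` pulls of that arm `a`.
Summing `1 / √k` and applying the Cauchy-Schwarz inequality over the arms gives `√(α T log T ∑ₐ P_a)` up to
a constant (`sum_gap_le`), and the forced pulls and the weights contribute at most `√T` each.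
-/

noncomputable section

namespace MARBandit

open scoped ENNReal

/-! ### Exponential weights along an interaction -/

section Interaction

variable {n K T : ℕ} {ν : Fin n → Measure (Outcome K)} {Ω : Type*} [mΩ : MeasurableSpace Ω]
  {P : Measure Ω} {ℱ : Filtration ℕ mΩ} {A : ℕ → Ω → Fin n} {Z : ℕ → Ω → Outcome K}

lemma IsInteraction.measurable_arm (h : IsInteraction T ν P ℱ A Z) {s t : ℕ} (hs : s < T)
    (hst : s ≤ t) : Measurable[ℱ t] (A s) :=
  (h.arm_measurable s hs).mono (ℱ.mono hst) le_rfl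

lemma IsInteraction.measurable_outcome (h : IsInteraction T ν P ℱ A Z) {s t : ℕ} (hs : s < T)
    (hst : s < t) : Measurable[ℱ t] (Z s) :=
  (h.outcome_measurable s hs).mono (ℱ.mono hst) le_rfl

/-- On the event that arm `a` is pulled in round `t`, the outcome of that round is independent of
the past and has law `ν a`. -/
lemma IsInteraction.setLIntegral_mul_outcome [IsFiniteMeasure P] (h : IsInteraction T ν P ℱ A Z)
    {t : ℕ} (ht : t < T) (a : Fin n) {φ : Outcome K → ℝ≥0∞} (hφ : Measurable φ) {f : Ω → ℝ≥0∞}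
    (hf : Measurable[ℱ t] f) :
    ∫⁻ ω in {ω | A t ω = a}, f ω * φ (Z t ω) ∂P =
      (∫⁻ ω in {ω | A t ω = a}, f ω ∂P) * ∫⁻ z, φ z ∂ν a := by
  have hZ : Measurable (Z t) := (h.outcome_measurable t ht).mono (ℱ.le _) le_rfl
  have hφZ : Measurable fun ω => φ (Z t ω) := hφ.comp hZ
  have hA : MeasurableSet {ω | A t ω = a} :=
    ℱ.le t _ (h.arm_measurable t ht (measurableSet_singleton a))
  refine @Measurable.ennreal_induction Ω (ℱ t)
    (fun f => ∫⁻ ω in {ω | A t ω = a}, f ω * φ (Z t ω) ∂P =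
      (∫⁻ ω in {ω | A t ω = a}, f ω ∂P) * ∫⁻ z, φ z ∂ν a) ?_ ?_ ?_ f hf
  · intro c F hF
    have hF' : MeasurableSet F := ℱ.le t _ hF
    have hmap : (P.restrict (F ∩ {ω | A t ω = a})).map (Z t)
        = P (F ∩ {ω | A t ω = a}) • ν a := by
      ext B hB
      rw [Measure.map_apply hZ hB, Measure.restrict_apply (hZ hB), Measure.smul_apply,
        smul_eq_mul, ← h.outcome_law t ht F hF a B hB, Set.inter_comm]
    have h1 : ∫⁻ ω in F ∩ {ω | A t ω = a}, φ (Z t ω) ∂P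
        = P (F ∩ {ω | A t ω = a}) * ∫⁻ z, φ z ∂ν a := by
      rw [← lintegral_map hφ hZ, hmap, lintegral_smul_measure, smul_eq_mul]
    have h2 : ∀ ω, F.indicator (fun _ => c) ω * φ (Z t ω)
        = F.indicator (fun ω => c * φ (Z t ω)) ω := by
      intro ω
      by_cases hω : ω ∈ F <;> simp [hω]
    simp_rw [h2]
    rw [lintegral_indicator hF', lintegral_indicator hF', Measure.restrict_restrict hF',
      lintegral_const_mul _ hφZ, h1, lintegral_const, Measure.restrict_apply_univ, mul_assoc]
  · intro f g _ hf hg ihf ihg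
    have hf' := hf.mono (ℱ.le t) le_rfl
    have hg' := hg.mono (ℱ.le t) le_rfl
    simp only [Pi.add_apply, add_mul]
    rw [lintegral_add_left (f := fun ω => f ω * φ (Z t ω)) (hf'.mul hφZ),
      lintegral_add_left hf', add_mul, ihf, ihg]
  · intro f hf hmono ih
    have hf' := fun i => (hf i).mono (ℱ.le t) le_rfl
    simp only [ENNReal.iSup_mul]
    rw [lintegral_iSup (f := fun i ω => f i ω * φ (Z t ω)) (fun i => (hf' i).mul hφZ)
      (fun i j hij ω => mul_le_mul_left (hmono hij ω) _), lintegral_iSup hf' hmono,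
      ENNReal.iSup_mul]
    exact iSup_congr ih

/-- A product of one-round factors, each of conditional mean at most one, has mean at most one. -/
lemma IsInteraction.lintegral_prod_le_one [IsProbabilityMeasure P]
    (h : IsInteraction T ν P ℱ A Z) {φ : Fin n → Outcome K → ℝ≥0∞} (hφ : ∀ a, Measurable (φ a))
    (hφ1 : ∀ a, ∫⁻ z, φ a z ∂ν a ≤ 1) {t : ℕ} (ht : t ≤ T) :
    ∫⁻ ω, ∏ s ∈ Finset.range t, φ (A s ω) (Z s ω) ∂P ≤ 1 := by
  induction t with
  | zero => simp
  | succ t ih =>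
    have htT : t < T := ht
    have hm : Measurable (fun x : Fin n × Outcome K => φ x.1 x.2) :=
      measurable_from_prod_countable_right hφ
    have hprod : Measurable[ℱ t] fun ω => ∏ s ∈ Finset.range t, φ (A s ω) (Z s ω) := by
      refine Finset.measurable_fun_prod _ fun s hs => ?_
      have hst : s < t := Finset.mem_range.1 hs
      exact hm.comp ((h.measurable_arm (hst.trans htT) hst.le).prodMk
        (h.measurable_outcome (hst.trans htT) hst))
    have hA : Measurable (A t) := (h.arm_measurable t htT).mono (ℱ.le _) le_rfl
    have hsplit : ∀ F : Ω → ℝ≥0∞, ∫⁻ ω, F ω ∂P = ∑ a, ∫⁻ ω in {ω | A t ω = a}, F ω ∂P := by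
      intro F
      have hAa : ∀ a, MeasurableSet {ω | A t ω = a} := fun a => hA (measurableSet_singleton a)
      rw [← tsum_fintype (L := .unconditional _), ← lintegral_iUnion hAa, ← setLIntegral_univ]
      · congr 2
        ext ω; simp
      · intro a b hab
        rw [Function.onFun, Set.disjoint_left]
        intro ω ha hb
        exact hab (ha.symm.trans hb)
    simp_rw [Finset.prod_range_succ]
    rw [hsplit]
    calc ∑ a, ∫⁻ ω in {ω | A t ω = a},
            (∏ s ∈ Finset.range t, φ (A s ω) (Z s ω)) * φ (A t ω) (Z t ω) ∂P
        = ∑ a, (∫⁻ ω in {ω | A t ω = a}, ∏ s ∈ Finset.range t, φ (A s ω) (Z s ω) ∂P)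
            * ∫⁻ z, φ a z ∂ν a := by
          refine Finset.sum_congr rfl fun a _ => ?_
          rw [← h.setLIntegral_mul_outcome htT a (hφ a) hprod]
          refine setLIntegral_congr_fun (hA (measurableSet_singleton a)) fun ω hω => ?_
          simp only [Set.mem_ofPred_eq] at hω
          simp only [hω]
      _ ≤ ∑ a, (∫⁻ ω in {ω | A t ω = a}, ∏ s ∈ Finset.range t, φ (A s ω) (Z s ω) ∂P) :=
          Finset.sum_le_sum fun a _ => mul_le_of_le_one_right' (hφ1 a)
      _ ≤ 1 := by rw [← hsplit]; exact ih htT.le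

/-- Exponential weights: if `exp (g a)` has mean at most one under `ν a` for every arm `a`, then
the exponential of the sum of `g` along the first `t` rounds has mean at most one. -/
lemma IsInteraction.integrable_exp_sum [IsProbabilityMeasure P]
    (h : IsInteraction T ν P ℱ A Z) {g : Fin n → Outcome K → ℝ} (hg : ∀ a, Measurable (g a))
    (hg1 : ∀ a, ∫⁻ z, ENNReal.ofReal (Real.exp (g a z)) ∂ν a ≤ 1) {t : ℕ} (ht : t ≤ T) :
    Integrable (fun ω => Real.exp (∑ s ∈ Finset.range t, g (A s ω) (Z s ω))) P ∧
      ∫ ω, Real.exp (∑ s ∈ Finset.range t, g (A s ω) (Z s ω)) ∂P ≤ 1 := by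
  have hm : Measurable (fun x : Fin n × Outcome K => g x.1 x.2) :=
    measurable_from_prod_countable_right hg
  have hmeas : Measurable fun ω => Real.exp (∑ s ∈ Finset.range t, g (A s ω) (Z s ω)) := by
    refine (Finset.measurable_fun_sum _ fun s hs => ?_).exp
    have hsT : s < T := (Finset.mem_range.1 hs).trans_le ht
    exact hm.comp (((h.arm_measurable s hsT).mono (ℱ.le _) le_rfl).prodMk
      ((h.outcome_measurable s hsT).mono (ℱ.le _) le_rfl))
  have hle : ∫⁻ ω, ENNReal.ofReal (Real.exp (∑ s ∈ Finset.range t, g (A s ω) (Z s ω))) ∂P ≤ 1 := by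
    have := h.lintegral_prod_le_one (φ := fun a z => ENNReal.ofReal (Real.exp (g a z)))
      (fun a => (hg a).exp.ennreal_ofReal) hg1 ht
    simpa only [Real.exp_sum, ENNReal.ofReal_prod_of_nonneg fun _ _ => (Real.exp_pos _).le]
      using this
  constructor
  · refine ⟨hmeas.aestronglyMeasurable, ?_⟩
    rw [hasFiniteIntegral_iff_ofReal (ae_of_all _ fun _ => (Real.exp_pos _).le)]
    exact hle.trans_lt ENNReal.one_lt_top
  · rw [integral_eq_lintegral_of_nonneg_ae (ae_of_all _ fun _ => (Real.exp_pos _).le)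
      hmeas.aestronglyMeasurable]
    exact ENNReal.toReal_le_of_le_ofReal zero_le_one (by simpa using hle)

end Interaction

/-! ### Admissible increments in a missing-at-random environment -/

section Environment

variable {n K : ℕ} {ν : Fin n → Measure (Outcome K)} {p γ : Fin n → Fin K → ℝ} {c : ℝ≥0}

lemma measurable_med : Measurable (med : Outcome K → Fin K) := measurable_fst

lemma measurable_obs : Measurable (obs : Outcome K → Bool) := measurable_fst.comp measurable_snd

lemma measurable_rew : Measurable (rew : Outcome K → ℝ) := measurable_snd.comp measurable_snd

lemma measurableSet_med (m : Fin K) : MeasurableSet {z : Outcome K | med z = m} :=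
  measurable_med (measurableSet_singleton m)

lemma measurableSet_obs : MeasurableSet {z : Outcome K | obs z = true} :=
  measurable_obs (measurableSet_singleton true)

lemma disjoint_med : Pairwise
    (Function.onFun Disjoint fun m : Fin K => {z : Outcome K | med z = m}) := by
  intro a b hab
  rw [Function.onFun, Set.disjoint_left]
  intro z ha hb
  exact hab (ha.symm.trans hb)

namespace IsMAREnvironment

variable (h : IsMAREnvironment ν p γ c)
include h

lemma measure_med_ne_zero (a : Fin n) (m : Fin K) : ν a {z | med z = m} ≠ 0 := by
  intro h0
  have := h.medProb_pos a m
  simp [medProb, measureReal_def, h0] at this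

lemma measure_med (a : Fin n) (m : Fin K) : ν a {z | med z = m} = ENNReal.ofReal (p a m) := by
  have := h.isProb a
  rw [← h.medProb_eq a m, medProb, ofReal_measureReal]

lemma isProb_condLaw (a : Fin n) (m : Fin K) : IsProbabilityMeasure (condLaw ν a m) := by
  have := h.isProb a
  exact cond_isProbabilityMeasure (h.measure_med_ne_zero a m)

lemma restrict_med (a : Fin n) (m : Fin K) :
    (ν a).restrict {z | med z = m} = ν a {z | med z = m} • condLaw ν a m := by
  have := h.isProb a
  rw [condLaw, ProbabilityTheory.cond, smul_smul,
    ENNReal.mul_inv_cancel (h.measure_med_ne_zero a m) (measure_ne_top _ _), one_smul]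

lemma p_pos (a : Fin n) (m : Fin K) : 0 < p a m := h.medProb_eq a m ▸ h.medProb_pos a m

lemma γ_pos (a : Fin n) (m : Fin K) : 0 < γ a m := h.obsProb_eq a m ▸ h.obsProb_pos a m

lemma γ_le_one (a : Fin n) (m : Fin K) : γ a m ≤ 1 := by
  have := h.isProb_condLaw a m
  rw [← h.obsProb_eq a m]
  exact measureReal_le_one

/-- The law of total expectation over the values of the mediator. -/
lemma lintegral_eq_sum (a : Fin n) (F : Fin K → Outcome K → ℝ≥0∞) :
    ∫⁻ z, F (med z) z ∂ν a = ∑ m, ENNReal.ofReal (p a m) * ∫⁻ z, F m z ∂condLaw ν a m := by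
  have huniv : (⋃ m : Fin K, {z : Outcome K | med z = m}) = Set.univ := by ext; simp
  rw [← setLIntegral_univ, ← huniv, lintegral_iUnion measurableSet_med disjoint_med, tsum_fintype]
  refine Finset.sum_congr rfl fun m _ => ?_
  rw [← h.measure_med, ← smul_eq_mul, ← lintegral_smul_measure, ← h.restrict_med]
  refine setLIntegral_congr_fun (measurableSet_med m) fun z hz => ?_
  simp only [Set.mem_ofPred_eq] at hz
  simp only [hz]

lemma sum_ofReal_p (a : Fin n) : ∑ m, ENNReal.ofReal (p a m) = 1 := by
  have := h.isProb a
  have h1 := h.lintegral_eq_sum a fun _ _ => 1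
  have := h.isProb_condLaw a
  simpa using h1.symm

lemma sum_p (a : Fin n) : ∑ m, p a m = 1 := by
  have h1 := h.sum_ofReal_p a
  rw [← ENNReal.ofReal_sum_of_nonneg fun m _ => (h.p_pos a m).le] at h1
  simpa using h1

lemma integrable_rew_condLaw (a : Fin n) (m : Fin K) : Integrable rew (condLaw ν a m) := by
  have := h.isProb_condLaw a m
  refine ((h.subGaussian a m).integrable.add (integrable_const (condMean ν a m))).congr
    (ae_of_all _ fun z => ?_)
  simp

lemma armMean_eq (a : Fin n) : armMean ν a = ∑ m, p a m * condMean ν a m := by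
  have := h.isProb a
  have huniv : (⋃ m : Fin K, {z : Outcome K | med z = m}) = Set.univ := by ext; simp
  rw [armMean, ← setIntegral_univ, ← huniv,
    integral_iUnion_fintype measurableSet_med disjoint_med]
  · refine Finset.sum_congr rfl fun m _ => ?_
    rw [h.restrict_med, integral_smul_measure, h.measure_med,
      ENNReal.toReal_ofReal (h.p_pos a m).le, smul_eq_mul, condMean]
  · intro m
    rw [IntegrableOn, h.restrict_med]
    exact (h.integrable_rew_condLaw a m).smul_measure (measure_ne_top _ _)

lemma armMean_nonneg (a : Fin n) : 0 ≤ armMean ν a := by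
  rw [h.armMean_eq]
  exact Finset.sum_nonneg fun m _ => mul_nonneg (h.p_pos a m).le (h.condMean_mem a m).1

lemma armMean_le_one (a : Fin n) : armMean ν a ≤ 1 := by
  rw [h.armMean_eq, ← h.sum_p a]
  exact Finset.sum_le_sum fun m _ => mul_le_of_le_one_right (h.p_pos a m).le (h.condMean_mem a m).2

end IsMAREnvironment

/-- The sub-Gaussian log-weight increment whose exponential controls the noise of the observed
rewards of arm `a`; `v m` is the weight given to the rewards observed with mediator `m`. -/
def noiseInc (ν : Fin n → Measure (Outcome K)) (c : ℝ≥0) (a : Fin n) (v : Fin K → ℝ)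
    (b : Fin n) (z : Outcome K) : ℝ :=
  if b = a ∧ obs z = true then
    v (med z) * (rew z - condMean ν a (med z)) - c / 2 * v (med z) ^ 2 else 0

/-- The increment whose exponential controls the lower deviations of the number of observed
rewards of arm `a` with mediator `m`, where `r` is the probability of such an observation. -/
def countInc (r : ℝ) (a : Fin n) (m : Fin K) (b : Fin n) (z : Outcome K) : ℝ :=
  if b = a then r / 2 - (if med z = m ∧ obs z = true then Real.log 2 else 0) else 0

lemma measurable_noiseInc (a : Fin n) (v : Fin K → ℝ) (b : Fin n) :
    Measurable (noiseInc ν c a v b) := by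
  have h1 : ∀ w : Fin K → ℝ, Measurable fun z : Outcome K => w (med z) :=
    fun w => (measurable_of_countable w).comp measurable_med
  refine Measurable.ite ?_ (((h1 v).mul (measurable_rew.sub (h1 _))).sub
    (((h1 v).pow_const 2).const_mul _)) measurable_const
  by_cases hb : b = a
  · simpa [hb] using measurableSet_obs
  · simp [hb]

lemma measurable_countInc (r : ℝ) (a : Fin n) (m : Fin K) (b : Fin n) :
    Measurable (countInc r a m b) := by
  unfold countInc
  split_ifs
  · exact measurable_const.sub (Measurable.ite ((measurableSet_med m).inter measurableSet_obs)
      measurable_const measurable_const)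
  · exact measurable_const

namespace IsMAREnvironment

variable (h : IsMAREnvironment ν p γ c)
include h

/-- Sub-Gaussianity survives the missingness: by the missing-at-random assumption the observation
indicator can be factored out of the conditional moment generating function. -/
lemma lintegral_exp_noise_condLaw_le_one (a : Fin n) (m : Fin K) (x : ℝ) :
    ∫⁻ z, ENNReal.ofReal (Real.exp (if obs z = true then
      x * (rew z - condMean ν a m) - c / 2 * x ^ 2 else 0)) ∂condLaw ν a m ≤ 1 := by
  have := h.isProb_condLaw a m
  set F : Bool → ℝ≥0∞ := fun o => if o = true then 1 else 0
  set G : ℝ → ℝ≥0∞ := fun y => ENNReal.ofReal (Real.exp (x * (y - condMean ν a m) - c / 2 * x ^ 2))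
  have hF : Measurable F := measurable_of_countable F
  have hG : Measurable G := by fun_prop
  have hind : IndepFun (fun z => F (obs z)) (fun z => G (rew z)) (condLaw ν a m) :=
    (h.mar a m).comp hF hG
  have hprod := lintegral_mul_eq_lintegral_mul_lintegral_of_indepFun''
    (hF.comp measurable_obs).aemeasurable (hG.comp measurable_rew).aemeasurable hind
  have hG1 : ∫⁻ z, G (rew z) ∂condLaw ν a m ≤ 1 := by
    have hsub := h.subGaussian a m
    have hint := (hsub.integrable_exp_mul x).mul_const (Real.exp (-(c / 2 * x ^ 2)))
    simp only [G, sub_eq_add_neg _ (c / 2 * x ^ 2 : ℝ), Real.exp_add]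
    rw [← ofReal_integral_eq_lintegral_ofReal hint (ae_of_all _ fun _ => by positivity),
      integral_mul_const]
    refine ENNReal.ofReal_le_one.2 ?_
    calc _ ≤ Real.exp (c * x ^ 2 / 2) * Real.exp (-(c / 2 * x ^ 2)) :=
          mul_le_mul_of_nonneg_right (hsub.mgf_le x) (Real.exp_pos _).le
      _ = 1 := by rw [← Real.exp_add, ← Real.exp_zero]; congr 1; ring
  calc ∫⁻ z, ENNReal.ofReal (Real.exp (if obs z = true then
          x * (rew z - condMean ν a m) - c / 2 * x ^ 2 else 0)) ∂condLaw ν a m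
      = ∫⁻ z, (F (obs z) * G (rew z) + F (!obs z)) ∂condLaw ν a m := by
        refine lintegral_congr fun z => ?_
        cases hz : obs z <;> simp [F, G]
    _ = (∫⁻ z, F (obs z) * G (rew z) ∂condLaw ν a m) + ∫⁻ z, F (!obs z) ∂condLaw ν a m :=
        lintegral_add_left ((hF.comp measurable_obs).mul (hG.comp measurable_rew)) _
    _ ≤ (∫⁻ z, F (obs z) ∂condLaw ν a m) + ∫⁻ z, F (!obs z) ∂condLaw ν a m := by
        exact add_le_add_left (hprod.trans_le (mul_le_of_le_one_right' hG1)) _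
    _ = ∫⁻ z, (F (obs z) + F (!obs z)) ∂condLaw ν a m :=
        (lintegral_add_left (hF.comp measurable_obs) _).symm
    _ = ∫⁻ _, 1 ∂condLaw ν a m := by
        refine lintegral_congr fun z => ?_
        cases hz : obs z <;> simp [F]
    _ = 1 := by simp

lemma lintegral_exp_noiseInc_le_one (a : Fin n) (v : Fin K → ℝ) (b : Fin n) :
    ∫⁻ z, ENNReal.ofReal (Real.exp (noiseInc ν c a v b z)) ∂ν b ≤ 1 := by
  have := h.isProb b
  by_cases hb : b = a
  · subst hb
    have h1 := h.lintegral_eq_sum b fun m z => ENNReal.ofReal (Real.exp (if obs z = true then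
      v m * (rew z - condMean ν b m) - c / 2 * v m ^ 2 else 0))
    simp only [noiseInc, true_and]
    rw [h1, ← h.sum_ofReal_p b]
    exact Finset.sum_le_sum fun m _ =>
      mul_le_of_le_one_right' (h.lintegral_exp_noise_condLaw_le_one b m (v m))
  · simp [noiseInc, hb]

lemma measureReal_med_obs (a : Fin n) (m : Fin K) :
    (ν a).real {z | med z = m ∧ obs z = true} = p a m * γ a m := by
  have := h.isProb a
  have h1 := h.restrict_med a m
  have h2 : (ν a) {z | med z = m ∧ obs z = true}
      = ENNReal.ofReal (p a m) * condLaw ν a m {z | obs z = true} := by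
    rw [← h.measure_med, ← smul_eq_mul, ← Measure.smul_apply, ← h1,
      Measure.restrict_apply measurableSet_obs]
    congr 1
    ext z
    exact and_comm
  rw [measureReal_def, h2, ENNReal.toReal_mul, ENNReal.toReal_ofReal (h.p_pos a m).le,
    ← h.obsProb_eq a m, obsProb, measureReal_def]

lemma lintegral_exp_countInc_le_one (a : Fin n) (m : Fin K) (b : Fin n) :
    ∫⁻ z, ENNReal.ofReal (Real.exp (countInc (p a m * γ a m) a m b z)) ∂ν b ≤ 1 := by
  have := h.isProb b
  by_cases hb : b = a
  · subst hb
    set r := p b m * γ b m with hr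
    set E : Set (Outcome K) := {z | med z = m ∧ obs z = true}
    have hE : MeasurableSet E := (measurableSet_med m).inter measurableSet_obs
    have hpt : ∀ z, Real.exp (countInc r b m b z)
        = Real.exp (r / 2) * (1 - E.indicator (fun _ => 1 / 2) z) := by
      intro z
      by_cases hz : med z = m ∧ obs z = true
      · have : z ∈ E := hz
        simp only [countInc, if_true, hz, and_self, this, Set.indicator_of_mem, Real.exp_sub]
        rw [Real.exp_log two_pos]; ring
      · have : z ∉ E := hz
        simp [countInc, hz, this]
    have hint : Integrable (fun z => Real.exp (r / 2) * (1 - E.indicator (fun _ => (1 / 2 : ℝ)) z))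
        (ν b) :=
      ((integrable_const _).sub ((integrable_const _).indicator hE)).const_mul _
    simp_rw [hpt]
    rw [← ofReal_integral_eq_lintegral_ofReal hint
      (ae_of_all _ fun z => (Real.exp_pos _).le.trans_eq (hpt z))]
    refine ENNReal.ofReal_le_one.2 ?_
    rw [integral_const_mul, integral_sub (integrable_const _)
      ((integrable_const _).indicator hE), integral_indicator_const _ hE,
      h.measureReal_med_obs b m, ← hr]
    have h1 : 1 - r / 2 ≤ Real.exp (-(r / 2)) := by
      have := Real.add_one_le_exp (-(r / 2)); linarith
    calc _ = Real.exp (r / 2) * (1 - r / 2) := by simp; ring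
      _ ≤ Real.exp (r / 2) * Real.exp (-(r / 2)) := by gcongr
      _ = 1 := by rw [← Real.exp_add]; simp
  · simp [countInc, hb]

end IsMAREnvironment

end Environment

/-! ### Concentration along a single run -/

section Pathwise

variable {n K : ℕ} {ν : Fin n → Measure (Outcome K)} {p γ : Fin n → Fin K → ℝ} {c : ℝ≥0}

/-- The number of pulls of arm `a` before round `t`. -/
def pulls (A : ℕ → Fin n) (t : ℕ) (a : Fin n) : ℕ := ((Finset.range t).filter fun s => A s = a).card

/-- The sum of the deviations of the observed rewards of arm `a` with mediator `m` from their
mean, before round `t`. -/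
def noiseSum (ν : Fin n → Measure (Outcome K)) (A : ℕ → Fin n) (z : ℕ → Outcome K) (t : ℕ)
    (a : Fin n) (m : Fin K) : ℝ :=
  ∑ s ∈ obsRounds A z t a m, (rew (z s) - condMean ν a m)

lemma sum_noiseInc (A : ℕ → Fin n) (z : ℕ → Outcome K) (t : ℕ) (a : Fin n) (v : Fin K → ℝ) :
    ∑ s ∈ Finset.range t, noiseInc ν c a v (A s) (z s) =
      ∑ m, (v m * noiseSum ν A z t a m - c / 2 * v m ^ 2 * obsCount A z t a m) := by
  have h1 : ∀ m, v m * noiseSum ν A z t a m - c / 2 * v m ^ 2 * obsCount A z t a m =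
      ∑ s ∈ Finset.range t, if A s = a ∧ med (z s) = m ∧ obs (z s) = true then
        v m * (rew (z s) - condMean ν a m) - c / 2 * v m ^ 2 else 0 := by
    intro m
    rw [← Finset.sum_filter, Finset.sum_sub_distrib, ← Finset.mul_sum, Finset.sum_const,
      nsmul_eq_mul, mul_comm (c / 2 * v m ^ 2 : ℝ)]
    rfl
  simp_rw [h1]
  rw [Finset.sum_comm]
  refine Finset.sum_congr rfl fun s _ => ?_
  rw [Finset.sum_eq_single (med (z s))]
  · simp [noiseInc]
  · intro m _ hm
    rw [if_neg]
    exact fun h => hm h.2.1.symm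
  · simp

lemma sum_countInc (A : ℕ → Fin n) (z : ℕ → Outcome K) (t : ℕ) (r : ℝ) (a : Fin n) (m : Fin K) :
    ∑ s ∈ Finset.range t, countInc r a m (A s) (z s) =
      pulls A t a * (r / 2) - obsCount A z t a m * Real.log 2 := by
  rw [pulls, obsCount, obsRounds, ← nsmul_eq_mul, ← nsmul_eq_mul, ← Finset.sum_const,
    ← Finset.sum_const, Finset.sum_filter, Finset.sum_filter, ← Finset.sum_sub_distrib]
  refine Finset.sum_congr rfl fun s _ => ?_
  by_cases h1 : A s = a <;> simp [countInc, h1]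

lemma obsCount_le (A : ℕ → Fin n) (z : ℕ → Outcome K) (t : ℕ) (a : Fin n) (m : Fin K) :
    obsCount A z t a m ≤ t :=
  (Finset.card_filter_le _ _).trans_eq (Finset.card_range t)

lemma IsMAREnvironment.armEst_sub_armMean (h : IsMAREnvironment ν p γ c) {A : ℕ → Fin n}
    {z : ℕ → Outcome K} {t : ℕ} {a : Fin n} (hN : ∀ m, obsCount A z t a m ≠ 0) :
    armEst p A z t a - armMean ν a =
      ∑ m, p a m / obsCount A z t a m * noiseSum ν A z t a m := by
  rw [h.armMean_eq, armEst, ← Finset.sum_sub_distrib]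
  refine Finset.sum_congr rfl fun m _ => ?_
  have hne : (obsCount A z t a m : ℝ) ≠ 0 := Nat.cast_ne_zero.2 (hN m)
  have hcard : ((obsRounds A z t a m).card : ℝ) = obsCount A z t a m := rfl
  rw [condEst, noiseSum, Finset.sum_sub_distrib, Finset.sum_const, nsmul_eq_mul, hcard]
  field_simp

/-- If fewer than half of the expected number of rewards are observed, then the exponent
associated with `countInc` is large. -/
lemma le_sum_countInc {A : ℕ → Fin n} {z : ℕ → Outcome K} {t : ℕ} {r : ℝ} {a : Fin n} {m : Fin K}
    (hN : (obsCount A z t a m : ℝ) < pulls A t a * r / 2) :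
    pulls A t a * r / 8 ≤ ∑ s ∈ Finset.range t, countInc r a m (A s) (z s) := by
  rw [sum_countInc]
  have h2 := Real.log_two_lt_d9
  have h0 : (0 : ℝ) ≤ obsCount A z t a m := Nat.cast_nonneg _
  nlinarith

/-- If a weighted mean of independent noise terms exceeds its confidence radius, then some weight
vector on a geometric grid has a large exponent. The ideal weights are proportional to
`p m / N m`; each is rounded to the grid upwards or downwards according to the sign of the noise
`S m`, so that rounding only costs a constant factor in the quadratic term. -/
lemma exists_zpow_weights {L T : ℝ} (hL : 1 ≤ L) {J : ℕ} {p N S : Fin K → ℝ}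
    (hp : ∀ m, 0 < p m) (hp1 : ∑ m, p m = 1) (hN1 : ∀ m, 1 ≤ N m) (hNT : ∀ m, N m ≤ T)
    (hJ1 : 3 * (1 + L) ≤ (6 / 5 : ℝ) ^ J) (hJ2 : ∀ m, 2 * T / p m ≤ (6 / 5 : ℝ) ^ J)
    (hD : √(L / 2 * ∑ m, p m ^ 2 / N m) ≤ ∑ m, p m / N m * S m) :
    ∃ i ∈ Fintype.piFinset fun _ : Fin K => Finset.Icc (-J : ℤ) J,
      2 / 3 * L ≤ ∑ m, ((6 / 5 : ℝ) ^ i m * S m - 1 / 8 * ((6 / 5 : ℝ) ^ i m) ^ 2 * N m) := by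
  set V := ∑ m, p m ^ 2 / N m with hV
  have hN0 : ∀ m, 0 < N m := fun m => one_pos.trans_le (hN1 m)
  have hterm : ∀ m, 0 < p m ^ 2 / N m := fun m => div_pos (pow_pos (hp m) 2) (hN0 m)
  have hple : ∀ m, p m ≤ 1 := fun m =>
    hp1 ▸ Finset.single_le_sum (fun j _ => (hp j).le) (Finset.mem_univ m)
  have hV1 : V ≤ 1 := by
    rw [hV, ← hp1]
    refine Finset.sum_le_sum fun m _ => ?_
    rw [div_le_iff₀ (hN0 m)]
    nlinarith [hp m, hple m, hN1 m, mul_nonneg (hp m).le (sub_nonneg.2 (hN1 m))]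
  have hVge : ∀ m, p m ^ 2 / N m ≤ V := fun m =>
    Finset.single_le_sum (fun j _ => (hterm j).le) (Finset.mem_univ m)
  have hV0 : 0 < V := by
    refine Finset.sum_pos (fun m _ => hterm m) ?_
    by_contra hne
    rw [Finset.not_nonempty_iff_eq_empty] at hne
    simp [hne] at hp1
  -- The exponent `x D - x² V / 8` is largest at `x = 4 R`; the factor `25 / 36` (the inverse square
  -- of the grid ratio `6 / 5`) compensates for the rounding.
  set R := √(L / (2 * V)) with hR
  have hR0 : 0 < R := Real.sqrt_pos.2 (by positivity)
  have hR2 : R ^ 2 = L / (2 * V) := Real.sq_sqrt (by positivity)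
  have hRD : R * √(L / 2 * V) = L / 2 := by
    rw [hR, ← Real.sqrt_mul (by positivity)]
    rw [show L / (2 * V) * (L / 2 * V) = (L / 2) ^ 2 by field_simp]
    exact Real.sqrt_sq (by positivity)
  set u : Fin K → ℝ := fun m => 25 / 9 * R * (p m / N m) with hu
  have hpN : ∀ m, 0 < p m / N m := fun m => div_pos (hp m) (hN0 m)
  have hu0 : ∀ m, 0 < u m := fun m => by have := hpN m; positivity
  have hb : (1 : ℝ) < 6 / 5 := by norm_num
  have hround : ∀ m, ∃ i : ℤ, u m * S m ≤ (6 / 5 : ℝ) ^ i * S m ∧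
      (6 / 5 : ℝ) ^ i ≤ 6 / 5 * u m ∧ u m ≤ 6 / 5 * (6 / 5 : ℝ) ^ i := by
    intro m
    obtain ⟨j, hj1, hj2⟩ := exists_mem_Ico_zpow (hu0 m) hb
    have hj3 : (6 / 5 : ℝ) ^ (j + 1) = 6 / 5 * (6 / 5 : ℝ) ^ j := by
      rw [zpow_add_one₀ (by norm_num), mul_comm]
    have hj0 : (0 : ℝ) < (6 / 5 : ℝ) ^ j := by positivity
    rcases le_total 0 (S m) with hS | hS
    · refine ⟨j + 1, mul_le_mul_of_nonneg_right hj2.le hS, ?_, ?_⟩ <;> rw [hj3] at hj2 ⊢ <;>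
        linarith
    · refine ⟨j, mul_le_mul_of_nonpos_right hj1 hS, ?_, ?_⟩ <;> linarith
  choose i hi1 hi2 hi3 using hround
  have hi0 : ∀ m, (0 : ℝ) < (6 / 5 : ℝ) ^ i m := fun m => by positivity
  refine ⟨i, ?_, ?_⟩
  · rw [Fintype.mem_piFinset]
    intro m
    rw [Finset.mem_Icc]
    have hsq : (R * (p m / N m)) ^ 2 ≤ L / 2 := by
      rw [mul_pow, hR2, div_mul_eq_mul_div, div_le_iff₀ (by positivity)]
      have h1 : (p m / N m) ^ 2 ≤ p m ^ 2 / N m := by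
        have := hN0 m
        rw [div_pow]
        gcongr
        nlinarith [hN1 m]
      nlinarith [hVge m]
    have hup : R * (p m / N m) ≤ (1 + L) / 2 := by
      refine le_of_sq_le_sq ?_ (by positivity)
      nlinarith [sq_nonneg (1 - L)]
    have hlow : p m / T ≤ 25 / 9 * (R * (p m / N m)) := by
      have hR1 : 1 / 2 ≤ R := by
        refine Real.le_sqrt_of_sq_le ?_
        rw [le_div_iff₀ (by positivity)]
        nlinarith
      have h1 : p m / T ≤ p m / N m := by
        have := hp m; have := hN0 m; have := hNT m
        gcongr
      have := hpN m
      nlinarith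
    have hT0 : 0 < T := (hN0 m).trans_le (hNT m)
    constructor
    · have h1 : (6 / 5 : ℝ) ^ (-(J : ℤ)) ≤ (6 / 5 : ℝ) ^ i m := by
        rw [zpow_neg, zpow_natCast]
        have h2 : ((6 / 5 : ℝ) ^ J)⁻¹ ≤ (2 * T / p m)⁻¹ :=
          inv_anti₀ (by have := hp m; positivity) (hJ2 m)
        have h3 : (2 * T / p m)⁻¹ = p m / T / 2 := by rw [inv_div]; ring
        have h4 := hi3 m
        simp only [hu] at h4
        have := hi0 m
        nlinarith
      exact (zpow_le_zpow_iff_right₀ hb).1 h1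
    · have h1 : (6 / 5 : ℝ) ^ i m ≤ (6 / 5 : ℝ) ^ (J : ℤ) := by
        rw [zpow_natCast]
        have h4 := hi2 m
        simp only [hu] at h4
        nlinarith
      exact (zpow_le_zpow_iff_right₀ hb).1 h1
  · rw [Finset.sum_sub_distrib]
    have h1 : 25 / 18 * L ≤ ∑ m, (6 / 5 : ℝ) ^ i m * S m := by
      calc 25 / 18 * L = 25 / 9 * (R * √(L / 2 * V)) := by rw [hRD]; ring
        _ ≤ 25 / 9 * (R * ∑ m, p m / N m * S m) := by gcongr
        _ = ∑ m, u m * S m := by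
            rw [Finset.mul_sum, Finset.mul_sum]
            exact Finset.sum_congr rfl fun m _ => by simp only [hu]; ring
        _ ≤ _ := Finset.sum_le_sum fun m _ => hi1 m
    have h2 : ∑ m, 1 / 8 * ((6 / 5 : ℝ) ^ i m) ^ 2 * N m ≤ 25 / 36 * L := by
      calc ∑ m, 1 / 8 * ((6 / 5 : ℝ) ^ i m) ^ 2 * N m
          ≤ ∑ m, 1 / 8 * (6 / 5 * u m) ^ 2 * N m := by
            refine Finset.sum_le_sum fun m _ => ?_
            have := hi0 m; have := hi2 m; have := hN0 m
            gcongr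
        _ = 25 / 18 * (R ^ 2 * V) := by
            rw [hV, Finset.mul_sum, Finset.mul_sum]
            refine Finset.sum_congr rfl fun m _ => ?_
            have := (hN0 m).ne'
            simp only [hu]; field_simp; ring
        _ = 25 / 36 * L := by rw [hR2]; field_simp; ring
    linarith

end Pathwise

/-! ### From concentration to regret -/

section Regret

variable {n K : ℕ} {ν : Fin n → Measure (Outcome K)} {p γ : Fin n → Fin K → ℝ} {c : ℝ≥0}

/-- The exploration bonus in `ucb`. -/
def radius (α : ℝ) (T : ℕ) (p : Fin n → Fin K → ℝ) (A : ℕ → Fin n) (z : ℕ → Outcome K)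
    (t : ℕ) (a : Fin n) : ℝ :=
  √(α * Real.log T / 2 * ∑ m, p a m ^ 2 / (obsCount A z t a m : ℝ))

lemma armMean_le_bestMean (a : Fin n) : armMean ν a ≤ bestMean ν :=
  le_ciSup (Set.finite_range _).bddAbove a

lemma FollowsAlgorithm.forcedPulls_le_pulls {α : ℝ} {T : ℕ} {A : ℕ → Fin n} {z : ℕ → Outcome K}
    (h : FollowsAlgorithm α T p A z) {t : ℕ} (ht : t < T) (hnt : n * forcedPulls T ≤ t)
    (a : Fin n) : forcedPulls T ≤ pulls A t a := by
  rw [pulls, ← Finset.card_range (forcedPulls T),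
    ← Finset.card_image_of_injective (Finset.range (forcedPulls T))
      (add_right_injective ((a : ℕ) * forcedPulls T))]
  refine Finset.card_le_card fun s hs => ?_
  obtain ⟨j, hj, rfl⟩ := Finset.mem_image.1 hs
  rw [Finset.mem_range] at hj
  have h1 : (a : ℕ) * forcedPulls T + j < n * forcedPulls T := by
    have : ((a : ℕ) + 1) * forcedPulls T ≤ n * forcedPulls T := Nat.mul_le_mul_right _ a.2
    rw [Nat.add_mul, one_mul] at this
    omega
  have hst : (a : ℕ) * forcedPulls T + j < t := h1.trans_le hnt
  rw [Finset.mem_filter, Finset.mem_range]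
  refine ⟨hst, Fin.ext ?_⟩
  rw [(h _ (hst.trans ht)).1 h1, mul_comm, Nat.mul_add_div (by omega), Nat.div_eq_of_lt hj,
    add_zero]

lemma sum_pulls (A : ℕ → Fin n) (t : ℕ) : ∑ a, pulls A t a = t := by
  have := Finset.card_eq_sum_card_fiberwise (f := A) (s := Finset.range t) (t := Finset.univ)
    (fun _ _ => by simp)
  rw [Finset.card_range] at this
  exact this.symm

lemma pulls_succ (A : ℕ → Fin n) (t : ℕ) (a : Fin n) :
    pulls A (t + 1) a = pulls A t a + if A t = a then 1 else 0 := by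
  rw [pulls, Finset.range_add_one, Finset.filter_insert]
  split_ifs
  · rw [Finset.card_insert_of_notMem (by simp)]; rfl
  · rfl

lemma sum_div_sqrt_pulls_le (A : ℕ → Fin n) {w : Fin n → ℝ} (hw : ∀ a, 0 ≤ w a) (t : ℕ) :
    ∑ s ∈ Finset.range t, w (A s) / √(pulls A s (A s)) ≤ 3 * ∑ a, w a * √(pulls A t a) := by
  induction t with
  | zero => simp [pulls]
  | succ t ih =>
    rw [Finset.sum_range_succ]
    have hstep : ∀ k : ℕ, 1 / √(k : ℝ) ≤ 3 * (√((k + 1 : ℕ) : ℝ) - √(k : ℝ)) := by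
      intro k
      rcases Nat.eq_zero_or_pos k with rfl | hk
      · simp
      have hk1 : (1 : ℝ) ≤ k := by exact_mod_cast hk
      have hx : 0 < √(k : ℝ) := Real.sqrt_pos.2 (by linarith)
      have hy : 0 < √((k + 1 : ℕ) : ℝ) := Real.sqrt_pos.2 (by positivity)
      have hx2 := Real.sq_sqrt (show (0 : ℝ) ≤ k by linarith)
      have hy2 := Real.sq_sqrt (show (0 : ℝ) ≤ ((k + 1 : ℕ) : ℝ) by positivity)
      push_cast at hy hy2 ⊢
      have hyx : √((k : ℝ) + 1) ≤ 2 * √(k : ℝ) := by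
        refine le_of_sq_le_sq ?_ (by positivity)
        nlinarith
      rw [div_le_iff₀ hx]
      have hd : 0 ≤ √((k : ℝ) + 1) - √(k : ℝ) :=
        sub_nonneg.2 (Real.sqrt_le_sqrt (by linarith))
      nlinarith
    have hsum : ∑ a, w a * √(pulls A (t + 1) a : ℝ) = ∑ a, w a * √(pulls A t a : ℝ) +
        w (A t) * (√((pulls A t (A t) + 1 : ℕ) : ℝ) - √(pulls A t (A t) : ℝ)) := by
      rw [← sub_eq_iff_eq_add', ← Finset.sum_sub_distrib, Finset.sum_eq_single (A t)]
      · rw [pulls_succ, if_pos rfl, mul_sub]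
      · intro a _ ha
        rw [pulls_succ, if_neg (Ne.symm ha), add_zero, sub_self]
      · simp
    rw [hsum, mul_add, ← mul_assoc, mul_comm 3 (w (A t)), mul_assoc, div_eq_mul_one_div]
    exact add_le_add ih (mul_le_mul_of_nonneg_left (hstep _) (hw _))

lemma IsMAREnvironment.armComplexity_nonneg (h : IsMAREnvironment ν p γ c) (a : Fin n) :
    0 ≤ armComplexity p γ a :=
  Finset.sum_nonneg fun m _ => div_nonneg (h.p_pos a m).le (h.γ_pos a m).le

lemma IsMAREnvironment.one_le_armComplexity (h : IsMAREnvironment ν p γ c) (a : Fin n) :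
    1 ≤ armComplexity p γ a := by
  rw [← h.sum_p a]
  exact Finset.sum_le_sum fun m _ =>
    le_div_self (h.p_pos a m).le (h.γ_pos a m) (h.γ_le_one a m)

lemma radius_le (h : IsMAREnvironment ν p γ c) {α : ℝ} (hα : 0 ≤ α) {T : ℕ} {A : ℕ → Fin n}
    {z : ℕ → Outcome K} {t : ℕ} {a : Fin n} (hk : 0 < pulls A t a)
    (hN : ∀ m, pulls A t a * (p a m * γ a m) / 2 ≤ obsCount A z t a m) :
    radius α T p A z t a ≤ √(α * Real.log T) * (√(armComplexity p γ a) / √(pulls A t a)) := by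
  have hk' : (0 : ℝ) < pulls A t a := Nat.cast_pos.2 hk
  have hL : 0 ≤ α * Real.log T := mul_nonneg hα (Real.log_natCast_nonneg T)
  rw [← Real.sqrt_div (h.armComplexity_nonneg a), ← Real.sqrt_mul hL]
  refine Real.sqrt_le_sqrt ?_
  rw [div_mul_eq_mul_div, mul_div_assoc]
  refine mul_le_mul_of_nonneg_left ?_ hL
  rw [div_le_iff₀ two_pos, armComplexity, Finset.sum_div, Finset.sum_mul]
  refine Finset.sum_le_sum fun m _ => ?_
  have hp := h.p_pos a m
  have hγ := h.γ_pos a m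
  calc p a m ^ 2 / (obsCount A z t a m : ℝ)
      ≤ p a m ^ 2 / (pulls A t a * (p a m * γ a m) / 2) := by
        have := hN m
        gcongr
    _ = _ := by field_simp

/-- One round of the optimistic phase: if all arm estimates are within their confidence radius,
up to a quarter of the gap of the pulled arm, then this gap is at most four times the radius. -/
lemma gap_le_of_ucb {α : ℝ} {T : ℕ} {A : ℕ → Fin n} {z : ℕ → Outcome K} {t : ℕ}
    (hucb : ∀ a, ucb α T p A z t a ≤ ucb α T p A z t (A t))
    (hN : ∀ a m, obsCount A z t a m ≠ 0)
    (herr : ∀ a, |armEst p A z t a - armMean ν a| ≤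
      radius α T p A z t a + (bestMean ν - armMean ν (A t)) / 4) :
    bestMean ν - armMean ν (A t) ≤ 4 * radius α T p A z t (A t) := by
  have : Nonempty (Fin n) := ⟨A t⟩
  obtain ⟨b, hb⟩ := exists_eq_ciSup_of_finite (f := armMean ν)
  change armMean ν b = bestMean ν at hb
  have h1 := hucb b
  have h2 : ∀ a, ¬ ∃ m, obsCount A z t a m = 0 := fun a ⟨m, hm⟩ => hN a m hm
  rw [ucb, ucb, if_neg (h2 _), if_neg (h2 _), EReal.coe_le_coe_iff] at h1
  change armEst p A z t b + radius α T p A z t b ≤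
    armEst p A z t (A t) + radius α T p A z t (A t) at h1
  have h3 := (abs_le.1 (herr b)).1
  have h4 := (abs_le.1 (herr (A t))).2
  linarith

/-- The regret along a single run. The nonnegative numbers `W t` are at least one in every round in
which the concentration of the counts or of the estimates fails. -/
lemma sum_gap_le (h : IsMAREnvironment ν p γ c) {α : ℝ} (hα : 0 ≤ α) {T : ℕ}
    (hT : 0 < forcedPulls T) {A : ℕ → Fin n} {z : ℕ → Outcome K}
    (hF : FollowsAlgorithm α T p A z) {W : ℕ → ℝ} (hW0 : ∀ t, 0 ≤ W t)
    (hW : ∀ t < T, n * forcedPulls T ≤ t → W t < 1 →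
      (∀ a m, pulls A t a * (p a m * γ a m) / 2 ≤ obsCount A z t a m) ∧
      (0 < bestMean ν - armMean ν (A t) → ∀ a, |armEst p A z t a - armMean ν a| ≤
        radius α T p A z t a + (bestMean ν - armMean ν (A t)) / 4)) :
    ∑ t ∈ Finset.range T, (bestMean ν - armMean ν (A t)) ≤
      n * forcedPulls T + ∑ t ∈ Finset.range T, W t +
        12 * √(α * T * Real.log T * ∑ a, armComplexity p γ a) := by
  have hL : 0 ≤ α * Real.log T := mul_nonneg hα (Real.log_natCast_nonneg T)
  have hgap : ∀ a, bestMean ν - armMean ν a ≤ 1 := by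
    intro a
    have : Nonempty (Fin n) := ⟨a⟩
    have h1 : bestMean ν ≤ 1 := ciSup_le h.armMean_le_one
    have h2 := h.armMean_nonneg a
    linarith
  have hround : ∀ t ∈ Finset.range T, bestMean ν - armMean ν (A t) ≤
      (if t < n * forcedPulls T then 1 else 0) + W t + 4 * √(α * Real.log T) *
        (√(armComplexity p γ (A t)) / √(pulls A t (A t))) := by
    intro t ht
    have htT := Finset.mem_range.1 ht
    have hlast : 0 ≤ 4 * √(α * Real.log T) *
        (√(armComplexity p γ (A t)) / √(pulls A t (A t))) := by positivity
    have hW0t := hW0 t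
    by_cases hforced : t < n * forcedPulls T
    · rw [if_pos hforced]
      linarith [hgap (A t)]
    rw [if_neg hforced]
    rw [not_lt] at hforced
    by_cases hW1 : 1 ≤ W t
    · linarith [hgap (A t)]
    obtain ⟨hN, herr⟩ := hW t htT hforced (not_le.1 hW1)
    have hk : ∀ a, 0 < pulls A t a := fun a =>
      hT.trans_le (hF.forcedPulls_le_pulls htT hforced a)
    rcases le_or_gt (bestMean ν - armMean ν (A t)) 0 with h0 | h0
    · linarith
    have hN0 : ∀ a m, obsCount A z t a m ≠ 0 := by
      intro a m h00
      have h1 := hN a m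
      have h2 : (0 : ℝ) < pulls A t a := Nat.cast_pos.2 (hk a)
      have h3 := mul_pos h2 (mul_pos (h.p_pos a m) (h.γ_pos a m))
      rw [h00, Nat.cast_zero] at h1
      linarith
    have h1 := gap_le_of_ucb (ν := ν) ((hF t htT).2 hforced) hN0 (herr h0)
    have h2 := radius_le h hα (T := T) (hk (A t)) (hN (A t))
    linarith
  refine (Finset.sum_le_sum hround).trans ?_
  rw [Finset.sum_add_distrib, Finset.sum_add_distrib, ← Finset.mul_sum]
  have hforced : ∑ t ∈ Finset.range T, (if t < n * forcedPulls T then (1 : ℝ) else 0) ≤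
      n * forcedPulls T := by
    rw [Finset.sum_boole]
    have h1 : ((Finset.range T).filter fun t => t < n * forcedPulls T).card ≤
        n * forcedPulls T := by
      refine (Finset.card_le_card fun t ht => ?_).trans_eq (Finset.card_range _)
      exact Finset.mem_range.2 (Finset.mem_filter.1 ht).2
    exact_mod_cast h1
  have hmain : ∑ t ∈ Finset.range T, √(armComplexity p γ (A t)) / √(pulls A t (A t)) ≤
      3 * (√(∑ a, armComplexity p γ a) * √T) := by
    refine (sum_div_sqrt_pulls_le A (w := fun a => √(armComplexity p γ a))
      (fun _ => Real.sqrt_nonneg _) T).trans ?_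
    refine mul_le_mul_of_nonneg_left ?_ (by norm_num)
    refine (Real.sum_sqrt_mul_sqrt_le _ h.armComplexity_nonneg
      (fun a => Nat.cast_nonneg _)).trans_eq ?_
    rw [← Nat.cast_sum, sum_pulls]
  have hsqrt : √(α * T * Real.log T * ∑ a, armComplexity p γ a) =
      √(α * Real.log T) * (√(∑ a, armComplexity p γ a) * √T) := by
    rw [← Real.sqrt_mul (Finset.sum_nonneg fun a _ => h.armComplexity_nonneg a),
      ← Real.sqrt_mul hL]
    congr 1; ring
  have h3 := mul_le_mul_of_nonneg_left hmain (show 0 ≤ 4 * √(α * Real.log T) by positivity)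
  rw [hsqrt]
  linarith

end Regret

section Expectation

variable {n K T : ℕ} {ν : Fin n → Measure (Outcome K)} {p γ : Fin n → Fin K → ℝ} {c : ℝ≥0}
  {Ω : Type*} [mΩ : MeasurableSpace Ω] {P : Measure Ω} {ℱ : Filtration ℕ mΩ} {A : ℕ → Ω → Fin n}
  {Z : ℕ → Ω → Outcome K} {α : ℝ}

/-- The total exponential weight at time `t` of a finite family of increments `g i`, the `i`-th of
which is discounted by `exp (-x i)`. -/
def totalWeight {ι : Type*} [Fintype ι] (g : ι → Fin n → Outcome K → ℝ) (x : ι → ℝ)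
    (A : ℕ → Fin n) (z : ℕ → Outcome K) (t : ℕ) : ℝ :=
  ∑ i, Real.exp (-x i) * Real.exp (∑ s ∈ Finset.range t, g i (A s) (z s))

lemma one_le_totalWeight {ι : Type*} [Fintype ι] {g : ι → Fin n → Outcome K → ℝ} {x : ι → ℝ}
    {A : ℕ → Fin n} {z : ℕ → Outcome K} {t : ℕ} (i : ι)
    (hi : x i ≤ ∑ s ∈ Finset.range t, g i (A s) (z s)) : 1 ≤ totalWeight g x A z t := by
  refine le_trans ?_ (Finset.single_le_sum (fun j _ => by positivity) (Finset.mem_univ i))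
  rw [← Real.exp_add]
  exact Real.one_le_exp (by linarith)

/-- The expected regret, given a finite family of exponential weights one of which is large in
every round in which concentration fails. -/
lemma integral_regret_le (h : IsMAREnvironment ν p γ c) (hα : 1 ≤ α)
    (hL : 1 ≤ Real.log T) (hrun : IsAlgorithmRun α T p ν P ℱ A Z)
    {ι : Type*} [Fintype ι] {g : ι → Fin n → Outcome K → ℝ} {x : ι → ℝ}
    (hg : ∀ i a, Measurable (g i a))
    (hg1 : ∀ i a, ∫⁻ z, ENNReal.ofReal (Real.exp (g i a z)) ∂ν a ≤ 1)
    (hforced : (n * forcedPulls T : ℝ) ≤ √T) (hx : T * ∑ i, Real.exp (-x i) ≤ √T)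
    (hgood : ∀ (A : ℕ → Fin n) (z : ℕ → Outcome K), ∀ t < T,
      (∀ a, forcedPulls T ≤ pulls A t a) →
      (∀ i, ∑ s ∈ Finset.range t, g i (A s) (z s) < x i) →
      (∀ a m, pulls A t a * (p a m * γ a m) / 2 ≤ obsCount A z t a m) ∧
      (0 < bestMean ν - armMean ν (A t) → ∀ a, |armEst p A z t a - armMean ν a| ≤
        radius α T p A z t a + (bestMean ν - armMean ν (A t)) / 4)) :
    ∫ ω, regret T ν A ω ∂P ≤ 14 * √(α * T * Real.log T * n * meanComplexity p γ) := by
  have := hrun.isProb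
  have hint := hrun.interaction
  -- There is at least one arm, since `Ω` is inhabited.
  obtain ⟨ω₀⟩ : Nonempty Ω := by
    by_contra hne
    rw [not_nonempty_iff] at hne
    have h1 := measure_univ (μ := P)
    rw [Set.univ_eq_empty_iff.2 hne, measure_empty] at h1
    exact zero_ne_one h1
  have hn : (n : ℝ) ≠ 0 := Nat.cast_ne_zero.2 (Fin.pos (A 0 ω₀)).ne'
  have hf : 0 < forcedPulls T := Nat.ceil_pos.2 (by positivity)
  set W : ℕ → Ω → ℝ := fun t ω => totalWeight g x (fun s => A s ω) (fun s => Z s ω) t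
  have hW0 : ∀ t ω, 0 ≤ W t ω := fun t ω => Finset.sum_nonneg fun i _ => by positivity
  have hWint : ∀ t < T, Integrable (W t) P := fun t ht =>
    integrable_finsetSum _ fun i _ =>
      (hint.integrable_exp_sum (hg i) (hg1 i) ht.le).1.const_mul _
  have hWle : ∀ t < T, ∫ ω, W t ω ∂P ≤ ∑ i, Real.exp (-x i) := by
    intro t ht
    simp only [W, totalWeight]
    rw [integral_finsetSum _ fun i _ =>
      (hint.integrable_exp_sum (hg i) (hg1 i) ht.le).1.const_mul _]
    refine Finset.sum_le_sum fun i _ => ?_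
    rw [integral_const_mul]
    exact mul_le_of_le_one_right (Real.exp_pos _).le
      (hint.integrable_exp_sum (hg i) (hg1 i) ht.le).2
  set B := √(α * T * Real.log T * ∑ a, armComplexity p γ a) with hB
  have hpath : ∀ᵐ ω ∂P, regret T ν A ω ≤
      n * forcedPulls T + ∑ t ∈ Finset.range T, W t ω + 12 * B := by
    filter_upwards [hrun.follows] with ω hω
    refine sum_gap_le h (by linarith) hf hω (hW0 · ω) fun t ht hnt hWt => ?_
    refine hgood _ _ t ht (hω.forcedPulls_le_pulls ht hnt) fun i => ?_
    by_contra hi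
    exact (one_le_totalWeight i (not_lt.1 hi)).not_gt hWt
  have hsumint : Integrable (fun ω => ∑ t ∈ Finset.range T, W t ω) P :=
    integrable_finsetSum _ fun t ht => hWint t (Finset.mem_range.1 ht)
  -- This absorbs the forced pulls and the weights; it uses `P_a ≥ 1`, as `γ ≤ 1`.
  have hTB : √T ≤ B := by
    refine Real.sqrt_le_sqrt ?_
    have hS : 1 ≤ ∑ a, armComplexity p γ a :=
      (h.one_le_armComplexity (A 0 ω₀)).trans
        (Finset.single_le_sum (fun a _ => h.armComplexity_nonneg a) (Finset.mem_univ _))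
    have hT0 : (0 : ℝ) ≤ T := Nat.cast_nonneg T
    calc (T : ℝ) = 1 * T * 1 * 1 := by ring
      _ ≤ α * T * Real.log T * ∑ a, armComplexity p γ a := by gcongr
  have hBS : √(α * T * Real.log T * n * meanComplexity p γ) = B := by
    rw [hB, meanComplexity, mul_assoc, mul_div_cancel₀ _ hn]
  rw [hBS]
  calc ∫ ω, regret T ν A ω ∂P
      ≤ ∫ ω, (n * forcedPulls T + ∑ t ∈ Finset.range T, W t ω + 12 * B) ∂P := by
        refine integral_mono_of_nonneg (ae_of_all _ fun ω => ?_)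
          (((integrable_const _).add hsumint).add (integrable_const _)) hpath
        exact Finset.sum_nonneg fun t _ => sub_nonneg.2 (armMean_le_bestMean _)
    _ = n * forcedPulls T + ∑ t ∈ Finset.range T, ∫ ω, W t ω ∂P + 12 * B := by
        rw [integral_add (f := fun ω => n * forcedPulls T + ∑ t ∈ Finset.range T, W t ω)
            ((integrable_const _).add hsumint) (integrable_const _),
          integral_add (integrable_const _) hsumint,
          integral_finsetSum _ fun t ht => hWint t (Finset.mem_range.1 ht)]
        simp
    _ ≤ √T + √T + 12 * B := by
        have h1 : ∑ t ∈ Finset.range T, ∫ ω, W t ω ∂P ≤ √T := by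
          refine (Finset.sum_le_sum fun t ht => hWle t (Finset.mem_range.1 ht)).trans ?_
          rw [Finset.sum_const, Finset.card_range, nsmul_eq_mul]
          exact hx
        linarith
    _ ≤ 14 * B := by linarith

end Expectation

/-! ### Large horizons -/

section Thresholds

open Filter

variable {n K : ℕ} {ν : Fin n → Measure (Outcome K)} {p γ : Fin n → Fin K → ℝ} {c : ℝ≥0}

lemma tendsto_log_natCast : Tendsto (fun T : ℕ => Real.log T) atTop atTop :=
  Real.tendsto_log_atTop.comp tendsto_natCast_atTop_atTop

lemma eventually_mul_pow_le_exp (C : ℝ) (k : ℕ) {b : ℝ} (hb : 0 < b) :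
    ∀ᶠ x : ℝ in atTop, C * x ^ k ≤ Real.exp (b * x) := by
  have h := (isLittleO_pow_exp_pos_mul_atTop k hb).bound
    (show (0 : ℝ) < (|C| + 1)⁻¹ by positivity)
  filter_upwards [h, eventually_ge_atTop 0] with x hx hx0
  have hxk : 0 ≤ x ^ k := pow_nonneg hx0 k
  rw [Real.norm_of_nonneg hxk, Real.norm_of_nonneg (Real.exp_pos _).le,
    inv_mul_eq_div, le_div_iff₀ (by positivity)] at hx
  nlinarith [le_abs_self C]

/-- Weights of size `exp (-κ log² T)` are negligible compared with any power of `T`. -/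
lemma eventually_mul_exp_neg_sq_le (C : ℝ) {κ : ℝ} (hκ : 0 < κ) :
    ∀ᶠ x : ℝ in atTop, Real.exp x * (C * Real.exp (-(κ * x ^ 2))) ≤ Real.exp (x / 2) := by
  filter_upwards [eventually_mul_pow_le_exp C 0 (show (0 : ℝ) < 1 / 2 by norm_num),
    eventually_ge_atTop (1 / κ), eventually_ge_atTop 0] with x hx hx1 hx0
  rw [pow_zero, mul_one] at hx
  rw [div_le_iff₀ hκ] at hx1
  calc Real.exp x * (C * Real.exp (-(κ * x ^ 2)))
      ≤ Real.exp x * (Real.exp (1 / 2 * x) * Real.exp (-x)) := by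
        gcongr
        nlinarith
    _ = Real.exp (x / 2) := by rw [← Real.exp_add, ← Real.exp_add]; congr 1; ring

lemma exists_pos_le_of_pos {ι : Type*} [Finite ι] (f : ι → ℝ) :
    ∃ δ : ℝ, 0 < δ ∧ ∀ i, 0 < f i → δ ≤ f i := by
  have h : ∀ᶠ δ : ℝ in nhdsWithin 0 (Set.Ioi 0), ∀ i, 0 < f i → δ ≤ f i := by
    rw [eventually_all]
    intro i
    by_cases hi : 0 < f i
    · filter_upwards [Ioo_mem_nhdsGT hi] with δ hδ _ using hδ.2.le
    · exact Eventually.of_forall fun _ h => absurd h hi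
  obtain ⟨δ, h1, h2⟩ := (h.and self_mem_nhdsWithin).exists
  exact ⟨δ, h2, h1⟩

/-- The expected regret for horizons beyond which the forced pulls and the count weights are
negligible; `v` is a family of weight vectors which detects all failures of the estimates. -/
lemma eventually_integral_regret_le (hp : ∀ a m, 0 < p a m) (hγ : ∀ a m, 0 < γ a m) :
    ∀ᶠ T : ℕ in atTop, ∀ (ν : Fin n → Measure (Outcome K)) (c : ℝ≥0),
      IsMAREnvironment ν p γ c → ∀ (α : ℝ), 1 ≤ α →
      ∀ {ι : Type} [Fintype ι] (v : ι → Fin K → ℝ) (y : ℝ),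
      T * (n * Fintype.card ι * Real.exp (-y)) ≤ √T / 2 →
      (∀ (A : ℕ → Fin n) (z : ℕ → Outcome K), ∀ t < T,
        (∀ a m, Real.log T ^ 2 * (p a m * γ a m) / 2 ≤ obsCount A z t a m) → ∀ a,
        (∀ i, ∑ m, (v i m * noiseSum ν A z t a m - c / 2 * v i m ^ 2 * obsCount A z t a m) < y) →
        0 < bestMean ν - armMean ν (A t) → |armEst p A z t a - armMean ν a| ≤
          radius α T p A z t a + (bestMean ν - armMean ν (A t)) / 4) →
      ∀ {Ω : Type*} [mΩ : MeasurableSpace Ω] (P : Measure Ω) (ℱ : Filtration ℕ mΩ)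
        (A : ℕ → Ω → Fin n) (Z : ℕ → Ω → Outcome K), IsAlgorithmRun α T p ν P ℱ A Z →
      ∫ ω, regret T ν A ω ∂P ≤ 14 * √(α * T * Real.log T * n * meanComplexity p γ) := by
  obtain ⟨ρ, hρ0, hρ⟩ := exists_pos_le_of_pos fun x : Fin n × Fin K => p x.1 x.2 * γ x.1 x.2
  have hρ' : ∀ a m, ρ ≤ p a m * γ a m := fun a m => hρ (a, m) (mul_pos (hp a m) (hγ a m))
  filter_upwards [tendsto_log_natCast.eventually_ge_atTop 1, eventually_gt_atTop 0,
    tendsto_log_natCast.eventually (eventually_mul_pow_le_exp (2 * n) 2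
      (show (0 : ℝ) < 1 / 2 by norm_num)),
    tendsto_log_natCast.eventually (eventually_mul_exp_neg_sq_le (2 * (n * K))
      (show (0 : ℝ) < ρ / 8 by positivity))]
    with T hL hT hforced hcount ν c h α hα ι _ v y hy hest Ω mΩ P ℱ A Z hrun
  have hT0 : (0 : ℝ) < T := Nat.cast_pos.2 hT
  have hsqrt : √(T : ℝ) = Real.exp (Real.log T / 2) := by
    rw [Real.exp_half, Real.exp_log hT0]
  have hf1 : Real.log T ^ 2 ≤ forcedPulls T := Nat.le_ceil _
  have hf2 : (forcedPulls T : ℝ) ≤ Real.log T ^ 2 + 1 := (Nat.ceil_lt_add_one (sq_nonneg _)).le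
  refine integral_regret_le h hα hL hrun (ι := (Fin n × Fin K) ⊕ (Fin n × ι))
    (g := Sum.elim (fun x => countInc (p x.1 x.2 * γ x.1 x.2) x.1 x.2)
      (fun x => noiseInc ν c x.1 (v x.2)))
    (x := Sum.elim (fun _ => ρ / 8 * Real.log T ^ 2) (fun _ => y)) ?_ ?_ ?_ ?_ ?_
  · rintro (i | i) a
    · exact measurable_countInc _ _ _ _
    · exact measurable_noiseInc _ _ _
  · rintro (i | i) a
    · exact h.lintegral_exp_countInc_le_one _ _ _
    · exact h.lintegral_exp_noiseInc_le_one _ _ _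
  · rw [hsqrt]
    have h0 : (0 : ℝ) ≤ n := Nat.cast_nonneg n
    calc (n * forcedPulls T : ℝ) ≤ n * (Real.log T ^ 2 + 1) := by gcongr
      _ ≤ 2 * n * Real.log T ^ 2 := by
          nlinarith [mul_nonneg h0 (sub_nonneg.2 (one_le_pow₀ hL : 1 ≤ Real.log T ^ 2))]
      _ ≤ Real.exp (1 / 2 * Real.log T) := hforced
      _ = _ := by congr 1; ring
  · rw [Fintype.sum_sum_type]
    simp only [Sum.elim_inl, Sum.elim_inr, Finset.sum_const, Finset.card_univ, Fintype.card_prod,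
      Fintype.card_fin, nsmul_eq_mul, Nat.cast_mul]
    rw [Real.exp_log hT0, ← hsqrt] at hcount
    linarith
  · intro A z t ht hpulls hx
    have hgood : ∀ a m, (pulls A t a : ℝ) * (p a m * γ a m) / 2 ≤ obsCount A z t a m := by
      intro a m
      by_contra hN
      have h1 := le_sum_countInc (not_le.1 hN)
      have h2 := hx (Sum.inl (a, m))
      simp only [Sum.elim_inl] at h2
      have h3 : (forcedPulls T : ℝ) ≤ pulls A t a := Nat.cast_le.2 (hpulls a)
      have h4 : Real.log T ^ 2 * ρ ≤ pulls A t a * (p a m * γ a m) :=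
        mul_le_mul (hf1.trans h3) (hρ' a m) hρ0.le (Nat.cast_nonneg _)
      linarith
    refine ⟨hgood, fun hgap a => hest A z t ht (fun a m => ?_) a (fun i => ?_) hgap⟩
    · have h3 : (forcedPulls T : ℝ) ≤ pulls A t a := Nat.cast_le.2 (hpulls a)
      have h4 := mul_le_mul_of_nonneg_right (hf1.trans h3) (mul_pos (hp a m) (hγ a m)).le
      linarith [hgood a m]
    · rw [← sum_noiseInc]
      exact hx (Sum.inr (a, i))

/-- For variance proxy `1 / 4` the confidence radii are valid whatever the gaps: the failures of
the estimates are detected by weight vectors on a geometric grid of polylogarithmic size. -/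
lemma eventually_integral_regret_le_quarter (hp : ∀ a m, 0 < p a m) (hγ : ∀ a m, 0 < γ a m) :
    ∀ᶠ T : ℕ in atTop, ∀ (ν : Fin n → Measure (Outcome K)),
      IsMAREnvironment ν p γ (1 / 4) → ∀ (α : ℝ), 1 ≤ α →
      ∀ {Ω : Type*} [mΩ : MeasurableSpace Ω] (P : Measure Ω) (ℱ : Filtration ℕ mΩ)
        (A : ℕ → Ω → Fin n) (Z : ℕ → Ω → Outcome K), IsAlgorithmRun α T p ν P ℱ A Z →
      ∫ ω, regret T ν A ω ∂P ≤ 14 * √(α * T * Real.log T * n * meanComplexity p γ) := by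
  obtain ⟨π, hπ0, hπ⟩ := exists_pos_le_of_pos fun x : Fin n × Fin K => p x.1 x.2
  have hπ' : ∀ a m, π ≤ p a m := fun a m => hπ (a, m) (hp a m)
  have hlog : 0 < Real.log (6 / 5) := Real.log_pos (by norm_num)
  filter_upwards [eventually_integral_regret_le hp hγ, eventually_gt_atTop 0,
    tendsto_log_natCast.eventually_ge_atTop 1,
    tendsto_log_natCast.eventually_ge_atTop (2 / Real.log (6 / 5)),
    tendsto_log_natCast.eventually (eventually_mul_pow_le_exp (2 / π) 0 one_pos),
    tendsto_log_natCast.eventually (eventually_mul_pow_le_exp 3 0 one_pos),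
    tendsto_log_natCast.eventually (eventually_mul_pow_le_exp (4 * n * 5 ^ K) (2 * K)
      (show (0 : ℝ) < 1 / 6 by norm_num))]
    with T hmain hT hL hL2 hpT h3T hcard ν h α hα Ω mΩ P ℱ A Z hrun
  rw [pow_zero, mul_one, one_mul] at hpT h3T
  have hT0 : (0 : ℝ) < T := Nat.cast_pos.2 hT
  set L := Real.log T with hLdef
  have hTL : (T : ℝ) = Real.exp L := (Real.exp_log hT0).symm
  set J := forcedPulls T
  have hJ1 : L ^ 2 ≤ J := Nat.le_ceil _
  have hJ2 : (J : ℝ) ≤ L ^ 2 + 1 := (Nat.ceil_lt_add_one (sq_nonneg _)).le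
  -- Every weight in question lies between `T⁻²` and `T²`, which `2 J + 1` grid points cover.
  have hgrid : Real.exp L * Real.exp L ≤ (6 / 5 : ℝ) ^ J := by
    rw [← Real.rpow_natCast, Real.rpow_def_of_pos (by norm_num), ← Real.exp_add]
    rw [div_le_iff₀ hlog] at hL2
    refine Real.exp_le_exp.2 ?_
    nlinarith
  set ι := Bool × (Fintype.piFinset fun _ : Fin K => Finset.Icc (-J : ℤ) J)
  refine hmain ν (1 / 4) h α hα (ι := ι)
    (fun i m => (if i.1 then 1 else -1) * (6 / 5 : ℝ) ^ i.2.1 m) (2 / 3 * L) ?_ ?_ P ℱ A Z hrun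
  · have hcardι : (Fintype.card ι : ℝ) ≤ 2 * (5 * L ^ 2) ^ K := by
      have h1 : Fintype.card ι = 2 * (2 * J + 1) ^ K := by
        simp only [ι, Fintype.card_prod, Fintype.card_bool, Fintype.card_coe,
          Fintype.card_piFinset, Int.card_Icc, Finset.prod_const, Finset.card_univ,
          Fintype.card_fin]
        congr 2
        omega
      rw [h1]
      push_cast
      gcongr
      nlinarith
    have hsqrt : √(T : ℝ) = Real.exp (L / 2) := by rw [Real.exp_half, ← hTL]
    rw [hsqrt, hTL]
    calc Real.exp L * (n * Fintype.card ι * Real.exp (-(2 / 3 * L)))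
        ≤ Real.exp L * (n * (2 * (5 * L ^ 2) ^ K) * Real.exp (-(2 / 3 * L))) := by gcongr
      _ = (4 * n * 5 ^ K * L ^ (2 * K)) * (Real.exp L * Real.exp (-(2 / 3 * L))) / 2 := by
          rw [mul_pow, ← pow_mul]; ring
      _ ≤ Real.exp (1 / 6 * L) * (Real.exp L * Real.exp (-(2 / 3 * L))) / 2 := by gcongr
      _ = Real.exp (L / 2) / 2 := by
          rw [← Real.exp_add, ← Real.exp_add]; congr 2; ring
  · intro A z t ht hN a hnoise hgap
    have hNpos : ∀ m, (0 : ℝ) < obsCount A z t a m := fun m =>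
      lt_of_lt_of_le (by have := hp a m; have := hγ a m; positivity) (hN a m)
    have hrad : √(L / 2 * ∑ m, p a m ^ 2 / (obsCount A z t a m : ℝ)) ≤ radius α T p A z t a := by
      refine Real.sqrt_le_sqrt ?_
      rw [← hLdef]
      refine mul_le_mul_of_nonneg_right ?_ (Finset.sum_nonneg fun m _ => by positivity)
      nlinarith
    have key : ∀ s : Bool, (if s then 1 else -1) * (armEst p A z t a - armMean ν a) ≤
        radius α T p A z t a := by
      intro s
      by_contra hs
      rw [h.armEst_sub_armMean fun m => Nat.cast_ne_zero.1 (hNpos m).ne'] at hs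
      obtain ⟨i, hi, hiL⟩ := exists_zpow_weights (T := T) hL (J := J) (p := p a)
        (N := fun m => obsCount A z t a m)
        (S := fun m => (if s then 1 else -1) * noiseSum ν A z t a m) (hp a) (h.sum_p a)
        (fun m => Nat.one_le_cast.2 (Nat.cast_pos.1 (hNpos m)))
        (fun m => Nat.cast_le.2 ((obsCount_le A z t a m).trans ht.le))
        (by
          refine le_trans ?_ hgrid
          have := Real.add_one_le_exp L
          nlinarith)
        (fun m => by
          refine le_trans ?_ hgrid
          rw [hTL, mul_div_right_comm]
          refine mul_le_mul_of_nonneg_right (le_trans ?_ hpT) (Real.exp_pos _).le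
          exact div_le_div_of_nonneg_left (by norm_num) hπ0 (hπ' a m))
        (by
          refine hrad.trans ((not_le.1 hs).le.trans_eq ?_)
          rw [Finset.mul_sum]
          exact Finset.sum_congr rfl fun m _ => by ring)
      refine (hnoise (s, ⟨i, hi⟩)).not_ge (hiL.trans_eq ?_)
      refine Finset.sum_congr rfl fun m _ => ?_
      push_cast
      cases s <;> simp only [if_true, Bool.false_eq_true, if_false] <;> ring
    have h1 := key true
    have h2 := key false
    simp only [if_true, Bool.false_eq_true, if_false] at h1 h2
    rw [abs_le]
    constructor <;> linarith

/-- For an arbitrary variance proxy, the forced pulls alone make every conditional mean estimate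
accurate up to a quarter of the smallest positive gap, with overwhelming probability. -/
lemma eventually_integral_regret_le_of_env (h : IsMAREnvironment ν p γ c) :
    ∀ᶠ T : ℕ in atTop, ∀ (α : ℝ), 1 ≤ α →
      ∀ {Ω : Type*} [mΩ : MeasurableSpace Ω] (P : Measure Ω) (ℱ : Filtration ℕ mΩ)
        (A : ℕ → Ω → Fin n) (Z : ℕ → Ω → Outcome K), IsAlgorithmRun α T p ν P ℱ A Z →
      ∫ ω, regret T ν A ω ∂P ≤ 14 * √(α * T * Real.log T * n * meanComplexity p γ) := by
  obtain ⟨δ, hδ0, hδ⟩ := exists_pos_le_of_pos fun a => bestMean ν - armMean ν a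
  obtain ⟨ρ, hρ0, hρ⟩ := exists_pos_le_of_pos fun x : Fin n × Fin K => p x.1 x.2 * γ x.1 x.2
  have hρ' : ∀ a m, ρ ≤ p a m * γ a m := fun a m =>
    hρ (a, m) (mul_pos (h.p_pos a m) (h.γ_pos a m))
  have hc : (0 : ℝ) ≤ c := c.2
  -- `c + 1` rather than `c`, so that the variance proxy may be zero.
  set lam : ℝ := δ / (4 * (c + 1)) with hlam
  set η : ℝ := δ ^ 2 / (32 * (c + 1)) with hη
  have hlam0 : 0 < lam := by positivity
  have hη0 : 0 < η := by positivity
  have hquad : η ≤ lam * (δ / 4) - c / 2 * lam ^ 2 := by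
    have h1 : lam * (δ / 4) - c / 2 * lam ^ 2 - η = δ ^ 2 / (32 * (c + 1) ^ 2) := by
      rw [hlam, hη]; field_simp; ring
    have h2 : 0 < δ ^ 2 / (32 * ((c : ℝ) + 1) ^ 2) := by positivity
    linarith
  filter_upwards [eventually_integral_regret_le h.p_pos h.γ_pos, eventually_gt_atTop 0,
    tendsto_log_natCast.eventually_ge_atTop 1,
    tendsto_log_natCast.eventually (eventually_mul_exp_neg_sq_le (2 * (n * (2 * K)))
      (show (0 : ℝ) < η * ρ / 2 by positivity))]
    with T hmain hT hL hexp α hα Ω mΩ P ℱ A Z hrun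
  have hT0 : (0 : ℝ) < T := Nat.cast_pos.2 hT
  refine hmain ν c h α hα (ι := Bool × Fin K)
    (fun i => Pi.single i.2 (if i.1 then lam else -lam)) (η * ρ / 2 * Real.log T ^ 2)
    ?_ ?_ P ℱ A Z hrun
  · rw [Real.exp_log hT0, Real.exp_half, Real.exp_log hT0] at hexp
    simp only [Fintype.card_prod, Fintype.card_bool, Fintype.card_fin, Nat.cast_mul,
      Nat.cast_ofNat]
    linarith
  · intro A z t ht hN a hnoise hgap
    have hNpos : ∀ m, (0 : ℝ) < obsCount A z t a m := fun m =>
      lt_of_lt_of_le (by have := h.p_pos a m; have := h.γ_pos a m; positivity) (hN a m)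
    have key : ∀ (s : Bool) (m : Fin K), (if s then 1 else -1) * noiseSum ν A z t a m ≤
        δ / 4 * obsCount A z t a m := by
      intro s m
      by_contra hs
      rw [not_le] at hs
      have h1 := hnoise (s, m)
      rw [Finset.sum_eq_single m (fun j _ hj => by simp [hj]) (by simp)] at h1
      simp only [Pi.single_eq_same] at h1
      have h2 : (if s then lam else -lam) * noiseSum ν A z t a m =
          lam * ((if s then 1 else -1) * noiseSum ν A z t a m) := by cases s <;> simp
      have h3 : (if s then lam else -lam) ^ 2 = lam ^ 2 := by cases s <;> simp
      rw [h2, h3] at h1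
      have h4 := mul_lt_mul_of_pos_left hs hlam0
      have h5 := mul_le_mul_of_nonneg_right hquad (hNpos m).le
      have h6 : Real.log T ^ 2 * ρ / 2 ≤ obsCount A z t a m := by
        refine le_trans ?_ (hN a m)
        have := hρ' a m
        gcongr
      have h7 := mul_le_mul_of_nonneg_left h6 hη0.le
      linarith
    have habs : |armEst p A z t a - armMean ν a| ≤ δ / 4 := by
      rw [h.armEst_sub_armMean fun m => Nat.cast_ne_zero.1 (hNpos m).ne']
      refine (Finset.abs_sum_le_sum_abs _ _).trans ?_
      rw [← mul_one (δ / 4), ← h.sum_p a, Finset.mul_sum]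
      refine Finset.sum_le_sum fun m _ => ?_
      have h1 : |noiseSum ν A z t a m| ≤ δ / 4 * obsCount A z t a m := by
        have h1 := key true m
        have h2 := key false m
        simp only [if_true, Bool.false_eq_true, if_false] at h1 h2
        exact abs_le.2 ⟨by linarith, by linarith⟩
      have hpm := h.p_pos a m
      rw [abs_mul, abs_of_pos (div_pos hpm (hNpos m)), div_mul_eq_mul_div, div_le_iff₀ (hNpos m)]
      nlinarith
    have h1 := hδ (A t) hgap
    have h2 : 0 ≤ radius α T p A z t a := Real.sqrt_nonneg _
    linarith

end Thresholds

end MARBandit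

end

theorem mainTheorem3 :
    ∃ C : ℝ, 0 < C ∧
      -- variance proxy `1/4`: the threshold `T₀` depends only on `α`, `n`, `K`, `p`, `γ`
      (∀ (n K : ℕ) (α : ℝ), 1 < α → ∀ p γ : Fin n → Fin K → ℝ,
        ∃ T₀ : ℕ, ∀ ν : Fin n → Measure (MARBandit.Outcome K),
          MARBandit.IsMAREnvironment ν p γ (1 / 4) →
          ∀ T : ℕ, T₀ ≤ T →
          ∀ (Ω : Type*) [mΩ : MeasurableSpace Ω] (P : Measure Ω) (ℱ : Filtration ℕ mΩ)
            (A : ℕ → Ω → Fin n) (Z : ℕ → Ω → MARBandit.Outcome K),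
            MARBandit.IsAlgorithmRun α T p ν P ℱ A Z →
            ∫ ω, MARBandit.regret T ν A ω ∂P ≤
              C * √(α * T * Real.log T * n * MARBandit.meanComplexity p γ)) ∧
      -- arbitrary variance proxy: the threshold `T₀` may also depend on `ν`
      (∀ (n K : ℕ) (α : ℝ), 1 < α → ∀ (p γ : Fin n → Fin K → ℝ) (c : ℝ≥0)
        (ν : Fin n → Measure (MARBandit.Outcome K)),
        MARBandit.IsMAREnvironment ν p γ c →
        ∃ T₀ : ℕ, ∀ T : ℕ, T₀ ≤ T →
          ∀ (Ω : Type*) [mΩ : MeasurableSpace Ω] (P : Measure Ω) (ℱ : Filtration ℕ mΩ)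
            (A : ℕ → Ω → Fin n) (Z : ℕ → Ω → MARBandit.Outcome K),
            MARBandit.IsAlgorithmRun α T p ν P ℱ A Z →
            ∫ ω, MARBandit.regret T ν A ω ∂P ≤
              C * √(α * T * Real.log T * n * MARBandit.meanComplexity p γ)) := by
  refine ⟨14, by norm_num, fun n K α hα p γ => ?_, fun n K α hα p γ c ν h => ?_⟩
  · -- If there is no environment with these parameters, then any threshold will do.
    by_cases hex : ∃ ν : Fin n → Measure (MARBandit.Outcome K),
        MARBandit.IsMAREnvironment ν p γ (1 / 4)
    · obtain ⟨ν₀, h₀⟩ := hex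
      obtain ⟨T₀, hT₀⟩ := Filter.eventually_atTop.1
        (MARBandit.eventually_integral_regret_le_quarter h₀.p_pos h₀.γ_pos)
      exact ⟨T₀, fun ν h T hT Ω _ P ℱ A Z hrun => hT₀ T hT ν h α hα.le P ℱ A Z hrun⟩
    · exact ⟨0, fun ν h => absurd ⟨ν, h⟩ hex⟩
  · obtain ⟨T₀, hT₀⟩ := Filter.eventually_atTop.1
      (MARBandit.eventually_integral_regret_le_of_env h)
    exact ⟨T₀, fun T hT Ω _ P ℱ A Z hrun => hT₀ T hT α hα.le P ℱ A Z hrun⟩
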